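/- Fix $T\in[0,\infty)$, $r\ge 0$, $\epsilon\in(0,1)$ and a Borel probability measure $m$ on $[0,\infty)$. Functions in $\mathbb{L}^2([0,T])$ are identified when equal almost everywhere, and integrals of $\mathbb{L}^2([0,T])$-valued functions are Bochner integrals. Let $\mathcal{G}$ be the set of $Q\in\mathbb{L}^2([0,T])$ with $0\le Q(t)\le \frac12$ for a.e. $t\in[0,T]$. For $x\ge 0$ let $Z_x=\{q\in\mathcal{G} : \int_0^T q_t\,dt\le x\}$; let $Z=\{(x,q) : x\ge 0,\ q\in Z_x\}\subseteq[0,\infty)\times\mathbb{L}^2([0,T])$, and let $\mathcal{P}_m(Z)$ be the set of Borel probability measures on $Z$ whose first marginal is $m$. For $Q\in\mathcal{G}$ and $x\ge0$, denote by $q^{Q}(x)$ the unique minimizer over $q\in Z_x$ of $$J^Q(q)=\int_0^T e^{-rt}q_t\,(q_t-1+\epsilon Q_t)\,dt,$$ and set $Q^{Q}=\int_0^\infty q^{Q}(x)\,dm(x)$. A Nash equilibrium is a $Q^*\in\mathcal{G}$ such that $Q^*=Q^{Q^*}$. Proposition. Let $\bar\mu$ be a solution of the potential problem $$\inf_{\mu\in\mathcal{P}_m(Z)}\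 \int_Z\int_0^T e^{-rt}(q_t^2-q_t)\,dt\,d\mu(x,q)+\frac{\epsilon}{2}\int_0^T e^{-rt}\Big(\int_Z q_t\,d\mu(x,q)\Big)^2dt,$$ where $\int_Z q_t\,d\mu(x,q)$ is the value at $t$ of $\int_Z q\,d\mu(x,q)\in\mathbb{L}^2([0,T])$. Then $Q^*=\int_Z q\,d\bar\mu(x,q)$ is a Nash equilibrium; that is, $Q^*\in\mathcal{G}$, the minimizer $q^{Q^*}(x)$ exists and is unique for every $x\ge0$, the map $x\mapsto q^{Q^*}(x)$ is $m$-integrable, and $Q^*=Q^{Q^*}$. -/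

import Mathlib

open MeasureTheory
open scoped NNReal

noncomputable section

namespace ExhaustibleResource

/-- The Hilbert space `L²([0,T], ℝ)`; its elements are classes of functions modulo almost everywhere
equality. -/
abbrev L2 (T : ℝ) : Type := Lp ℝ 2 (volume.restrict (Set.Icc (0 : ℝ) T))

/-- `L²([0,T], ℝ)` carries its Borel sigma-algebra. -/
instance instMeasurableSpaceL2 (T : ℝ) : MeasurableSpace (L2 T) := borel (L2 T)

instance instBorelSpaceL2 (T : ℝ) : BorelSpace (L2 T) := ⟨rfl⟩

/-- The set `𝒢` of the `Q ∈ L²([0,T])` with `0 ≤ Q(t) ≤ 1/2` for (almost) every `t ∈ [0,T]`. -/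
def production (T : ℝ) : Set (L2 T) :=
  {Q | ∀ᵐ t ∂(volume.restrict (Set.Icc (0 : ℝ) T)), 0 ≤ Q t ∧ Q t ≤ 1 / 2}

/-- The feasible controls of a producer with initial stock `x`:
those `q ∈ 𝒢` with `∫₀ᵀ q_t dt ≤ x`. -/
def feasible (T : ℝ) (x : ℝ≥0) : Set (L2 T) :=
  {q | q ∈ production T ∧ ∫ t in Set.Icc (0 : ℝ) T, q t ≤ (x : ℝ)}

/-- The cost `J^Q(q) = ∫₀ᵀ e^{-rt} q_t (q_t - 1 + ε Q_t) dt` of a producer facing the aggregate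
production `Q`. -/
def producerCost (T r ε : ℝ) (Q q : L2 T) : ℝ :=
  ∫ t in Set.Icc (0 : ℝ) T, Real.exp (-r * t) * (q t * (q t - 1 + ε * Q t))

/-- `q` solves the optimal control problem of a producer with initial stock `x`, given the
aggregate production `Q`. -/
def IsOptimalControl (T r ε : ℝ) (Q : L2 T) (x : ℝ≥0) (q : L2 T) : Prop :=
  q ∈ feasible T x ∧ ∀ q' ∈ feasible T x, producerCost T r ε Q q ≤ producerCost T r ε Q q'

/-- `b` is the best-response map `x ↦ q^Q(x)`: for each initial stock `x`, the control `b x` is the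
unique solution of the optimal control problem. -/
def IsBestResponseMap (T r ε : ℝ) (Q : L2 T) (b : ℝ≥0 → L2 T) : Prop :=
  ∀ x : ℝ≥0, ∀ q : L2 T, IsOptimalControl T r ε Q x q ↔ q = b x

/-- `Q` is a Nash equilibrium for the distribution `m` of initial stocks: `Q ∈ 𝒢` and
`Q = ∫ q^Q(x) dm(x)`, an integral in `L²([0,T])` whose existence is part of the claim. -/
def IsNashEquilibrium (T r ε : ℝ) (m : Measure ℝ≥0) (Q : L2 T) : Prop :=
  Q ∈ production T ∧
    ∃ b : ℝ≥0 → L2 T, IsBestResponseMap T r ε Q b ∧ Integrable b m ∧ Q = ∫ x, b x ∂m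

/-- The graph `Z` of the set-valued map `x ↦ feasible T x`, a subset of `[0,∞) × L²([0,T])`. -/
def graphZ (T : ℝ) : Set (ℝ≥0 × L2 T) :=
  {z | z.2 ∈ feasible T z.1}

/-- `𝒫_m(Z)`: the Borel probability measures on `Z` whose first marginal is `m`. -/
def admissible (T : ℝ) (m : Measure ℝ≥0) : Set (Measure (graphZ T)) :=
  {μ | IsProbabilityMeasure μ ∧ μ.map (fun z => z.1.1) = m}

/-- The aggregate `∫_Z q dμ(x,q)`, a Bochner integral in `L²([0,T])`. -/
def aggregate (T : ℝ) (μ : Measure (graphZ T)) : L2 T :=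
  ∫ z, z.1.2 ∂μ

/-- The criterion of the potential problem:
`∫_Z ∫₀ᵀ e^{-rt} (q_t² - q_t) dt dμ(x,q) + (ε/2) ∫₀ᵀ e^{-rt} (∫_Z q_t dμ(x,q))² dt`. -/
def potentialCost (T r ε : ℝ) (μ : Measure (graphZ T)) : ℝ :=
  (∫ z, (∫ t in Set.Icc (0 : ℝ) T, Real.exp (-r * t) * ((z.1.2 t) ^ 2 - z.1.2 t)) ∂μ) +
    ε / 2 * ∫ t in Set.Icc (0 : ℝ) T, Real.exp (-r * t) * (aggregate T μ t) ^ 2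

/-- `μ` solves the potential problem: it minimizes the criterion over `𝒫_m(Z)`. -/
def IsPotentialSolution (T r ε : ℝ) (m : Measure ℝ≥0) (μ : Measure (graphZ T)) : Prop :=
  μ ∈ admissible T m ∧ ∀ ν ∈ admissible T m, potentialCost T r ε μ ≤ potentialCost T r ε ν

end ExhaustibleResource

end

open Set Filter Topology
open scoped ENNReal InnerProductSpace

/-! A deviation from `μ` to `ν` within `𝒫_m(Z)` moves the mean cost and the aggregate affinely, so
the first-order condition of the potential problem at `μ` says that `∫ J^Q dμ ≤ ∫ J^Q dν`, where
`Q` is the aggregate of `μ`. Completing the square, `J^Q` is up to a constant a squared distance in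
the discounted norm, so the best response `q^Q(x)` is a projection on a closed convex set: it
exists, is unique, and depends measurably on `x` because the feasible sets grow with `x`. Testing
the first-order condition with the deviation `(x, q) ↦ (x, q^Q(x))` shows that `μ` is carried by
the graph of `q^Q`. -/

/-- `b` minimizes `J` on `K` with quadratic growth: the excess cost of a competitor controls its
squared distance to `b`. The constant multiplies the excess cost, so `C = 0` is allowed and
minimality is a separate field. -/
structure IsStrongMinOn {E : Type*} [PseudoMetricSpace E] (C : ℝ≥0) (J : E → ℝ) (K : Set E)
    (b : E) : Prop where
  mem : b ∈ K
  isMinOn : IsMinOn J K b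
  dist_sq_le : ∀ q ∈ K, dist q b ^ 2 ≤ C * (J q - J b)

theorem IsStrongMinOn.eq_of_le {E : Type*} [MetricSpace E] {C : ℝ≥0} {J : E → ℝ} {K : Set E}
    {b q : E} (hb : IsStrongMinOn C J K b) (hq : q ∈ K) (hle : J q ≤ J b) : q = b := by
  have h : dist q b ^ 2 ≤ 0 :=
    (hb.dist_sq_le q hq).trans (mul_nonpos_of_nonneg_of_nonpos C.2 (sub_nonpos.2 hle))
  exact dist_eq_zero.1 (sq_eq_zero_iff.1 (h.antisymm (sq_nonneg _)))

theorem stronglyMeasurable_of_continuous_induced {α β E : Type*} [MeasurableSpace α]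
    [TopologicalSpace β] [SecondCountableTopology β] [MeasurableSpace β] [BorelSpace β]
    [TopologicalSpace E] [TopologicalSpace.PseudoMetrizableSpace E] {v : α → β}
    (hv : Measurable v) {f : α → E} (hf : Continuous[.induced v ‹_›, _] f) :
    StronglyMeasurable f := by
  let _ : TopologicalSpace α := .induced v ‹_›
  have : SecondCountableTopology α := TopologicalSpace.secondCountableTopology_induced α β v
  have hle : borel α ≤ ‹MeasurableSpace α› := by
    rw [borel_comap, ← BorelSpace.measurable_eq (α := β)]
    exact hv.comap_le
  have hborel : StronglyMeasurable[borel α] f := by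
    let _ : MeasurableSpace α := borel α
    have : BorelSpace α := ⟨rfl⟩
    exact hf.stronglyMeasurable
  exact hborel.mono hle

theorem stronglyMeasurable_of_dist_sq_le {α E : Type*} [MeasurableSpace α] [PseudoMetricSpace E]
    {v : α → ℝ} (hv : Measurable v) {f : α → E} (C : ℝ)
    (h : ∀ x y, dist (f x) (f y) ^ 2 ≤ C * |v x - v y|) : StronglyMeasurable f := by
  refine stronglyMeasurable_of_continuous_induced hv ?_
  let _ : TopologicalSpace α := .induced v inferInstance
  have hv_cont : Continuous v := continuous_induced_dom
  refine continuous_iff_continuousAt.2 fun y => tendsto_iff_dist_tendsto_zero.2 ?_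
  have hlim : Tendsto (fun x => √(C * |v x - v y|)) (𝓝 y) (𝓝 0) := by
    have : Continuous fun x => √(C * |v x - v y|) := by fun_prop
    simpa using this.tendsto y
  exact squeeze_zero (fun _ => dist_nonneg) (fun x => Real.le_sqrt_of_sq_le (h x y)) hlim

theorem stronglyMeasurable_of_isStrongMinOn {α E : Type*} [LinearOrder α] [TopologicalSpace α]
    [OrderClosedTopology α] [MeasurableSpace α] [BorelSpace α] [PseudoMetricSpace E] {C : ℝ≥0}
    {J : E → ℝ} {K : α → Set E} (hK : Monotone K) {b : α → E}
    (hb : ∀ x, IsStrongMinOn C J (K x) (b x)) : StronglyMeasurable b := by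
  have hanti : Antitone fun x => J (b x) := fun x y hxy => (hb y).isMinOn (hK hxy (hb x).mem)
  have hdist : ∀ x y, x ≤ y → dist (b x) (b y) ^ 2 ≤ C * |J (b x) - J (b y)| := fun x y hxy =>
    ((hb y).dist_sq_le _ (hK hxy (hb x).mem)).trans
      (mul_le_mul_of_nonneg_left (le_abs_self _) C.2)
  refine stronglyMeasurable_of_dist_sq_le hanti.measurable C fun x y => ?_
  rcases le_total x y with hxy | hyx
  · exact hdist x y hxy
  · rw [dist_comm, abs_sub_comm]
    exact hdist y x hyx

section Hilbert

variable {H : Type*} [NormedAddCommGroup H] [InnerProductSpace ℝ H]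

theorem exists_norm_sub_sq_add_norm_sub_sq_le {K : Set H} (hne : K.Nonempty) (hK : IsComplete K)
    (hconv : Convex ℝ K) (v : H) :
    ∃ p ∈ K, ∀ w ∈ K, ‖w - p‖ ^ 2 + ‖p - v‖ ^ 2 ≤ ‖w - v‖ ^ 2 := by
  obtain ⟨p, hp, hmin⟩ := exists_norm_eq_iInf_of_complete_convex hne hK hconv v
  refine ⟨p, hp, fun w hw => ?_⟩
  have hobtuse := (norm_eq_iInf_iff_real_inner_le_zero hconv hp).1 hmin w hw
  have hexpand := norm_add_sq_real (w - p) (p - v)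
  rw [sub_add_sub_cancel, real_inner_comm, ← neg_sub v p, inner_neg_left] at hexpand
  rw [← neg_sub v p]
  linarith

theorem exists_isStrongMinOn_norm_sub_sq {E : Type*} [NormedAddCommGroup E] [NormedSpace ℝ E]
    {S : E →L[ℝ] H} {C : ℝ≥0} (hS : AntilipschitzWith C S) {K : Set E} (hne : K.Nonempty)
    (hK : IsComplete K) (hconv : Convex ℝ K) (v : H) (a : ℝ) :
    ∃ b, IsStrongMinOn (C ^ 2) (fun q => ‖S q - v‖ ^ 2 + a) K b := by
  have hSK : IsComplete (S '' K) :=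
    isComplete_image_iff (hS.isUniformInducing S.uniformContinuous) |>.2 hK
  obtain ⟨_, ⟨b, hb, rfl⟩, hproj⟩ := exists_norm_sub_sq_add_norm_sub_sq_le (hne.image S) hSK
    (hconv.is_linear_image S.toLinearMap.isLinear) v
  have hgrowth : ∀ q ∈ K, ‖S q - S b‖ ^ 2 + ‖S b - v‖ ^ 2 ≤ ‖S q - v‖ ^ 2 := fun q hq =>
    hproj _ (mem_image_of_mem S hq)
  refine ⟨b, hb, fun q hq => ?_, fun q hq => ?_⟩
  · have := hgrowth q hq
    change ‖S b - v‖ ^ 2 + a ≤ ‖S q - v‖ ^ 2 + a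
    linarith [sq_nonneg ‖S q - S b‖]
  · calc dist q b ^ 2 ≤ (C * ‖S q - S b‖) ^ 2 := by
          rw [← dist_eq_norm]
          exact pow_le_pow_left₀ dist_nonneg (hS.le_mul_dist q b) 2
      _ = (C ^ 2 : ℝ≥0) * ‖S q - S b‖ ^ 2 := by push_cast; ring
      _ ≤ (C ^ 2 : ℝ≥0) * (‖S q - v‖ ^ 2 + a - (‖S b - v‖ ^ 2 + a)) :=
          mul_le_mul_of_nonneg_left (by linarith [hgrowth q hq]) (C ^ 2).2

theorem add_inner_le_of_isMinOn_segment {κ : ℝ} {y z : ℝ × H}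
    (hmin : IsMinOn (fun w : ℝ × H => w.1 + κ / 2 * ‖w.2‖ ^ 2) (segment ℝ y z) y) :
    y.1 + κ * ⟪y.2, y.2⟫_ℝ ≤ z.1 + κ * ⟪y.2, z.2⟫_ℝ := by
  have hderiv : HasFDerivAt (fun w : ℝ × H => w.1 + κ / 2 * ‖w.2‖ ^ 2) _ y :=
    hasFDerivAt_fst.add (hasFDerivAt_snd.norm_sq.const_mul (κ / 2))
  have hcone : z - y ∈ posTangentConeAt (segment ℝ y z) y :=
    mem_posTangentConeAt_of_segment_subset (by rw [add_sub_cancel])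
  have h := hmin.localize.hasFDerivWithinAt_nonneg hderiv.hasFDerivWithinAt hcone
  simp only [add_apply, ContinuousLinearMap.coe_fst', Prod.fst_sub, smul_apply,
    ContinuousLinearMap.comp_apply, ContinuousLinearMap.coe_snd', Prod.snd_sub, coe_innerSL_apply,
    inner_sub_right, nsmul_eq_mul, Nat.cast_ofNat, smul_eq_mul] at h
  linarith

end Hilbert

section AEMem

variable {α E : Type*} [MeasurableSpace α] {P : Measure α} [NormedAddCommGroup E] {p : ℝ≥0∞}
  {s : Set E}

theorem isClosed_setOf_ae_mem [Fact (1 ≤ p)] (hs : IsClosed s) :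
    IsClosed {f : Lp E p P | ∀ᵐ t ∂P, f t ∈ s} := by
  refine IsSeqClosed.isClosed fun f g hf hfg => ?_
  obtain ⟨φ, -, hφ⟩ := (tendstoInMeasure_of_tendsto_Lp hfg).exists_seq_tendsto_ae
  filter_upwards [hφ, ae_all_iff.2 hf] with t hlim hmem
  exact hs.mem_of_tendsto hlim (Eventually.of_forall fun n => hmem (φ n))

theorem convex_setOf_ae_mem [NormedSpace ℝ E] (hs : Convex ℝ s) :
    Convex ℝ {f : Lp E p P | ∀ᵐ t ∂P, f t ∈ s} := by
  intro f hf g hg a b ha hb hab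
  filter_upwards [hf, hg, Lp.coeFn_add (a • f) (b • g), Lp.coeFn_smul a f, Lp.coeFn_smul b g]
    with t hft hgt hadd hfa hgb
  rw [hadd, Pi.add_apply, hfa, hgb]
  exact hs hft hgt ha hb hab

theorem isBounded_setOf_ae_mem [IsFiniteMeasure P] [Fact (1 ≤ p)] (hs : Bornology.IsBounded s) :
    Bornology.IsBounded {f : Lp E p P | ∀ᵐ t ∂P, f t ∈ s} := by
  obtain ⟨C, hC, hbound⟩ := hs.exists_pos_norm_le
  refine isBounded_iff_forall_norm_le.2 ⟨_, fun f hf => Lp.norm_le_of_ae_bound hC.le ?_⟩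
  filter_upwards [hf] with t ht using hbound _ ht

theorem memLp_of_forall_mem_isBounded [IsFiniteMeasure P] (hs : Bornology.IsBounded s) {f : α → E}
    (hf : AEStronglyMeasurable f P) (hfs : ∀ ω, f ω ∈ s) : MemLp f p P := by
  obtain ⟨C, hbound⟩ := isBounded_iff_forall_norm_le.1 hs
  exact MemLp.of_bound hf C (ae_of_all _ fun ω => hbound _ (hfs ω))

end AEMem

namespace ExhaustibleResource

variable {T r ε : ℝ}

section Multiplication

theorem memLp_top_exp_mul (T a : ℝ) :
    MemLp (fun t => Real.exp (a * t)) ⊤ (volume.restrict (Icc (0 : ℝ) T)) := by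
  refine memLp_top_of_bound (by fun_prop) (Real.exp (|a| * T)) ?_
  filter_upwards [ae_restrict_mem measurableSet_Icc] with t ht
  rw [Real.norm_eq_abs, Real.abs_exp, Real.exp_le_exp]
  calc a * t ≤ |a| * t := mul_le_mul_of_nonneg_right (le_abs_self a) ht.1
    _ ≤ |a| * T := mul_le_mul_of_nonneg_left ht.2 (abs_nonneg a)

/-- Multiplication by `t ↦ e^{at}` on `L²([0,T])`. With `a = -r/2` it turns the discounted inner
product `∫₀ᵀ e^{-rt} f_t g_t dt` into the inner product of `L²([0,T])`. -/
noncomputable def expMul (T a : ℝ) : L2 T →L[ℝ] L2 T :=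
  (ContinuousLinearMap.mul ℝ ℝ).holderL (volume.restrict (Icc (0 : ℝ) T)) ⊤ 2 2
    (memLp_top_exp_mul T a).toLp

theorem coeFn_expMul (a : ℝ) (f : L2 T) :
    expMul T a f =ᵐ[volume.restrict (Icc (0 : ℝ) T)] fun t => Real.exp (a * t) * f t :=
  (ContinuousLinearMap.coeFn_holder (r := 2) (ContinuousLinearMap.mul ℝ ℝ)
    (memLp_top_exp_mul T a).toLp f).trans
    ((memLp_top_exp_mul T a).coeFn_toLp.mul .rfl)

theorem expMul_neg_expMul (a : ℝ) (f : L2 T) : expMul T (-a) (expMul T a f) = f := by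
  refine Lp.ext ?_
  filter_upwards [coeFn_expMul (-a) (expMul T a f), coeFn_expMul a f] with t hout hin
  rw [hout, hin, ← mul_assoc, ← Real.exp_add]
  simp

theorem antilipschitz_expMul (T a : ℝ) : AntilipschitzWith ‖expMul T (-a)‖₊ (expMul T a) :=
  (expMul T (-a)).lipschitz.to_rightInverse (expMul_neg_expMul a)

theorem inner_expMul_expMul (r : ℝ) (f g : L2 T) :
    ⟪expMul T (-r / 2) f, expMul T (-r / 2) g⟫_ℝ =
      ∫ t in Icc (0 : ℝ) T, Real.exp (-r * t) * (f t * g t) := by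
  rw [L2.inner_def]
  refine integral_congr_ae ?_
  filter_upwards [coeFn_expMul (-r / 2) f, coeFn_expMul (-r / 2) g] with t hf hg
  rw [hf, hg, show -r * t = -r / 2 * t + -r / 2 * t by ring, Real.exp_add]
  simp only [RCLike.inner_apply, conj_trivial]
  ring

end Multiplication

section Feasible

/-- The constant function `1` in `L²([0,T])`. -/
noncomputable def oneL2 (T : ℝ) : L2 T := Lp.const 2 (volume.restrict (Icc (0 : ℝ) T)) 1

theorem coeFn_oneL2 (T : ℝ) : ∀ᵐ t ∂(volume.restrict (Icc (0 : ℝ) T)), oneL2 T t = 1 :=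
  Lp.coeFn_const 2 (volume.restrict (Icc (0 : ℝ) T)) 1

theorem inner_oneL2 (q : L2 T) : ⟪oneL2 T, q⟫_ℝ = ∫ t in Icc (0 : ℝ) T, q t := by
  rw [L2.inner_def]
  refine integral_congr_ae ?_
  filter_upwards [coeFn_oneL2 T] with t ht
  simp [ht]

theorem isClosed_production (T : ℝ) : IsClosed (production T) :=
  isClosed_setOf_ae_mem isClosed_Icc

theorem convex_production (T : ℝ) : Convex ℝ (production T) :=
  convex_setOf_ae_mem (convex_Icc 0 (1 / 2))

theorem isBounded_production (T : ℝ) : Bornology.IsBounded (production T) :=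
  isBounded_setOf_ae_mem (Metric.isBounded_Icc 0 (1 / 2))

theorem feasible_eq_inter (T : ℝ) (x : ℝ≥0) :
    feasible T x = production T ∩ {q | ⟪oneL2 T, q⟫_ℝ ≤ x} := by
  simp only [inner_oneL2]
  rfl

theorem isClosed_feasible (T : ℝ) (x : ℝ≥0) : IsClosed (feasible T x) := by
  rw [feasible_eq_inter]
  exact (isClosed_production T).inter (isClosed_le (by fun_prop) continuous_const)

theorem convex_feasible (T : ℝ) (x : ℝ≥0) : Convex ℝ (feasible T x) := by
  rw [feasible_eq_inter]
  exact (convex_production T).inter (convex_halfSpace_le (innerₛₗ ℝ (oneL2 T)).isLinear x)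

theorem zero_mem_feasible (T : ℝ) (x : ℝ≥0) : 0 ∈ feasible T x := by
  rw [feasible_eq_inter]
  refine ⟨?_, by simp⟩
  filter_upwards [Lp.coeFn_zero ℝ 2 (volume.restrict (Icc (0 : ℝ) T))] with t ht
  exact ⟨ht.ge, ht.le.trans one_half_pos.le⟩

theorem monotone_feasible (T : ℝ) : Monotone (feasible T) :=
  fun _ _ hxy _ hq => ⟨hq.1, hq.2.trans (NNReal.coe_le_coe.2 hxy)⟩

end Feasible

section Cost

theorem producerCost_eq_inner (r ε : ℝ) (Q q : L2 T) :
    producerCost T r ε Q q =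
      ⟪expMul T (-r / 2) q, expMul T (-r / 2) (q - oneL2 T + ε • Q)⟫_ℝ := by
  rw [inner_expMul_expMul]
  refine integral_congr_ae ?_
  filter_upwards [Lp.coeFn_add (q - oneL2 T) (ε • Q), Lp.coeFn_sub q (oneL2 T),
    Lp.coeFn_smul ε Q, coeFn_oneL2 T] with t hadd hsub hsmul hone
  rw [hadd, Pi.add_apply, hsub, Pi.sub_apply, hsmul, Pi.smul_apply, hone, smul_eq_mul]

theorem producerCost_eq_norm_sub_sq (r ε : ℝ) (Q q : L2 T) :
    producerCost T r ε Q q =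
      ‖expMul T (-r / 2) q - expMul T (-r / 2) ((1 / 2 : ℝ) • (oneL2 T - ε • Q))‖ ^ 2 +
        -‖expMul T (-r / 2) ((1 / 2 : ℝ) • (oneL2 T - ε • Q))‖ ^ 2 := by
  have hcenter : q - oneL2 T + ε • Q = q - (2 : ℝ) • (1 / 2 : ℝ) • (oneL2 T - ε • Q) := by
    module
  rw [producerCost_eq_inner, hcenter, map_sub, map_smul, inner_sub_right, real_inner_smul_right,
    real_inner_self_eq_norm_sq, norm_sub_sq_real]
  ring

/-- The cost `∫₀ᵀ e^{-rt} (q_t² - q_t) dt` of a producer without competitors. -/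
noncomputable abbrev monopolyCost (T r : ℝ) : L2 T → ℝ := producerCost T r 0 0

theorem producerCost_eq_monopolyCost_add (r ε : ℝ) (Q q : L2 T) :
    producerCost T r ε Q q = monopolyCost T r q +
      ε * ⟪expMul T (-r / 2) Q, expMul T (-r / 2) q⟫_ℝ := by
  rw [monopolyCost, producerCost_eq_inner, producerCost_eq_inner, map_add, inner_add_right,
    map_smul, real_inner_smul_right, real_inner_comm (expMul T (-r / 2) q), zero_smul, add_zero]

theorem continuous_producerCost (r ε : ℝ) (Q : L2 T) : Continuous (producerCost T r ε Q) := by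
  simp only [funext (producerCost_eq_inner r ε Q)]
  fun_prop

variable {Ω : Type*} [MeasurableSpace Ω] {P : Measure Ω} [IsFiniteMeasure P] {f : Ω → L2 T}

theorem integrable_of_mem_production (hf : AEStronglyMeasurable f P)
    (hprod : ∀ ω, f ω ∈ production T) : Integrable f P :=
  memLp_one_iff_integrable.1 (memLp_of_forall_mem_isBounded (isBounded_production T) hf hprod)

theorem integrable_producerCost (r ε : ℝ) (Q : L2 T) (hf : AEStronglyMeasurable f P)
    (hprod : ∀ ω, f ω ∈ production T) : Integrable (fun ω => producerCost T r ε Q (f ω)) P := by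
  have hf_sq : MemLp f (2 : ℕ) P :=
    memLp_of_forall_mem_isBounded (isBounded_production T) hf hprod
  simp only [producerCost_eq_norm_sub_sq]
  exact (((expMul T (-r / 2)).comp_memLp' hf_sq).sub (memLp_const _)).integrable_norm_pow
    two_ne_zero |>.add (integrable_const _)

end Cost

section BestResponse

theorem exists_isStrongMinOn_producerCost (r ε : ℝ) (Q : L2 T) (x : ℝ≥0) :
    ∃ b, IsStrongMinOn (‖expMul T (-(-r / 2))‖₊ ^ 2) (producerCost T r ε Q) (feasible T x) b := by
  rw [funext (producerCost_eq_norm_sub_sq r ε Q)]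
  exact exists_isStrongMinOn_norm_sub_sq (antilipschitz_expMul T (-r / 2))
    ⟨0, zero_mem_feasible T x⟩ (isClosed_feasible T x).isComplete (convex_feasible T x) _ _

theorem exists_stronglyMeasurable_isBestResponseMap (r ε : ℝ) (Q : L2 T) :
    ∃ b, IsBestResponseMap T r ε Q b ∧ StronglyMeasurable b := by
  choose b hb using exists_isStrongMinOn_producerCost r ε Q
  refine ⟨b, fun x q => ⟨fun hq => ?_, ?_⟩,
    stronglyMeasurable_of_isStrongMinOn (monotone_feasible T) hb⟩
  · exact (hb x).eq_of_le hq.1 (hq.2 _ (hb x).mem)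
  · rintro rfl
    exact ⟨(hb x).mem, (hb x).isMinOn⟩

variable {Q : L2 T} {b : ℝ≥0 → L2 T}

theorem IsBestResponseMap.isOptimalControl (hb : IsBestResponseMap T r ε Q b) (x : ℝ≥0) :
    IsOptimalControl T r ε Q x (b x) :=
  (hb x (b x)).2 rfl

theorem IsBestResponseMap.eq_of_producerCost_eq (hb : IsBestResponseMap T r ε Q b) {x : ℝ≥0}
    {q : L2 T} (hq : q ∈ feasible T x)
    (hcost : producerCost T r ε Q (b x) = producerCost T r ε Q q) : q = b x :=
  (hb x q).1 ⟨hq, fun q' hq' => hcost ▸ (hb.isOptimalControl x).2 q' hq'⟩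

end BestResponse

section Admissible

variable {m : Measure ℝ≥0} {μ ν : Measure (graphZ T)}

theorem measurable_stock (T : ℝ) : Measurable (fun z : graphZ T => z.1.1) :=
  measurable_fst.comp measurable_subtype_coe

theorem stronglyMeasurable_control (T : ℝ) : StronglyMeasurable (fun z : graphZ T => z.1.2) :=
  have : Fact ((2 : ℝ≥0∞) ≠ ⊤) := ⟨ENNReal.ofNat_ne_top⟩
  (measurable_snd.comp measurable_subtype_coe).stronglyMeasurable

theorem integrable_control (μ : Measure (graphZ T)) [IsFiniteMeasure μ] :
    Integrable (fun z : graphZ T => z.1.2) μ :=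
  integrable_of_mem_production (stronglyMeasurable_control T).aestronglyMeasurable fun z => z.2.1

theorem integrable_producerCost_control (r ε : ℝ) (Q : L2 T) (μ : Measure (graphZ T))
    [IsFiniteMeasure μ] : Integrable (fun z : graphZ T => producerCost T r ε Q z.1.2) μ :=
  integrable_producerCost r ε Q (stronglyMeasurable_control T).aestronglyMeasurable fun z => z.2.1

theorem aggregate_mem_production (μ : Measure (graphZ T)) [IsProbabilityMeasure μ] :
    aggregate T μ ∈ production T :=
  (convex_production T).integral_mem (isClosed_production T) (ae_of_all _ fun z => z.2.1)
    (integrable_control μ)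

theorem convex_admissible (T : ℝ) (m : Measure ℝ≥0) : Convex ℝ≥0 (admissible T m) := by
  rintro μ ⟨hμ, hμm⟩ ν ⟨hν, hνm⟩ a b - - hab
  refine ⟨⟨?_⟩, ?_⟩
  · simp [← ENNReal.coe_add, hab]
  · rw [Measure.map_add _ _ (measurable_stock T), Measure.map_smul, Measure.map_smul, hμm, hνm,
      ← add_smul, hab, one_smul]

theorem map_mem_admissible (hμ : μ ∈ admissible T m) {ψ : graphZ T → graphZ T}
    (hψ : Measurable ψ) (hstock : ∀ z, (ψ z).1.1 = z.1.1) : μ.map ψ ∈ admissible T m := by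
  have := hμ.1
  refine ⟨Measure.isProbabilityMeasure_map hψ.aemeasurable, ?_⟩
  rw [Measure.map_map (measurable_stock T) hψ, ← hμ.2]
  exact congrArg μ.map (funext hstock)

end Admissible

section Potential

variable {m : Measure ℝ≥0} {μ ν : Measure (graphZ T)}

/-- The mean monopoly cost under `μ` and the discounted aggregate of `μ`: the two quantities,
affine in `μ`, through which the criterion of the potential problem depends on `μ`. -/
noncomputable def moments (T r : ℝ) (μ : Measure (graphZ T)) : ℝ × L2 T :=
  (∫ z, monopolyCost T r z.1.2 ∂μ, expMul T (-r / 2) (aggregate T μ))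

theorem moments_add_smul (r : ℝ) (μ ν : Measure (graphZ T)) [IsFiniteMeasure μ]
    [IsFiniteMeasure ν] (a b : ℝ≥0) :
    moments T r (a • μ + b • ν) = a • moments T r μ + b • moments T r ν := by
  refine Prod.ext ?_ ?_
  · simp only [moments, Prod.fst_add, Prod.smul_fst]
    rw [integral_add_measure (integrable_producerCost_control r 0 0 _)
      (integrable_producerCost_control r 0 0 _), integral_smul_nnreal_measure,
      integral_smul_nnreal_measure]
  · simp only [moments, aggregate, Prod.snd_add, Prod.smul_snd]
    rw [integral_add_measure (integrable_control _) (integrable_control _),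
      integral_smul_nnreal_measure, integral_smul_nnreal_measure, map_add]
    simp only [NNReal.smul_def, map_smul]

theorem potentialCost_eq_moments (r ε : ℝ) (μ : Measure (graphZ T)) :
    potentialCost T r ε μ = (moments T r μ).1 + ε / 2 * ‖(moments T r μ).2‖ ^ 2 := by
  have hmonopoly : ∀ q : L2 T, ∫ t in Icc (0 : ℝ) T, Real.exp (-r * t) * ((q t) ^ 2 - q t) =
      monopolyCost T r q := fun q => integral_congr_ae (ae_of_all _ fun t => by
    simp only [zero_mul]
    ring)
  simp only [moments, ← real_inner_self_eq_norm_sq, inner_expMul_expMul, potentialCost,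
    hmonopoly, ← sq]

theorem integral_producerCost_eq_moments (r ε : ℝ) (Q : L2 T) (μ : Measure (graphZ T))
    [IsFiniteMeasure μ] :
    ∫ z, producerCost T r ε Q z.1.2 ∂μ =
      (moments T r μ).1 + ε * ⟪expMul T (-r / 2) Q, (moments T r μ).2⟫_ℝ := by
  have hS : Integrable (fun z : graphZ T => expMul T (-r / 2) z.1.2) μ :=
    (expMul T (-r / 2)).integrable_comp (integrable_control μ)
  simp only [producerCost_eq_monopolyCost_add r ε Q]
  rw [integral_add (integrable_producerCost_control r 0 0 μ) ((hS.const_inner _).const_mul ε),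
    integral_const_mul, integral_inner hS,
    (expMul T (-r / 2)).integral_comp_comm (integrable_control μ)]
  rfl

theorem IsPotentialSolution.integral_producerCost_le (hμ : IsPotentialSolution T r ε m μ)
    (hν : ν ∈ admissible T m) :
    ∫ z, producerCost T r ε (aggregate T μ) z.1.2 ∂μ ≤
      ∫ z, producerCost T r ε (aggregate T μ) z.1.2 ∂ν := by
  have := hμ.1.1
  have := hν.1
  have hmin : IsMinOn (fun w : ℝ × L2 T => w.1 + ε / 2 * ‖w.2‖ ^ 2)
      (segment ℝ (moments T r μ) (moments T r ν)) (moments T r μ) := by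
    rintro _ ⟨a, b, ha, hb, hab, rfl⟩
    lift a to ℝ≥0 using ha
    lift b to ℝ≥0 using hb
    have hmix : a • μ + b • ν ∈ admissible T m :=
      convex_admissible T m hμ.1 hν zero_le zero_le (mod_cast hab)
    have hle := hμ.2 _ hmix
    rwa [potentialCost_eq_moments, potentialCost_eq_moments, moments_add_smul] at hle
  rw [integral_producerCost_eq_moments, integral_producerCost_eq_moments]
  exact add_inner_le_of_isMinOn_segment hmin

theorem IsPotentialSolution.ae_control_eq (hμ : IsPotentialSolution T r ε m μ) {b : ℝ≥0 → L2 T}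
    (hb : IsBestResponseMap T r ε (aggregate T μ) b) (hb_meas : StronglyMeasurable b) :
    ∀ᵐ z ∂μ, z.1.2 = b z.1.1 := by
  have := hμ.1.1
  set J := producerCost T r ε (aggregate T μ)
  let ψ : graphZ T → graphZ T := fun z => ⟨(z.1.1, b z.1.1), (hb.isOptimalControl z.1.1).1⟩
  have hb_stock : StronglyMeasurable fun z : graphZ T => b z.1.1 :=
    hb_meas.comp_measurable (measurable_stock T)
  have hψ : Measurable ψ := ((measurable_stock T).prodMk hb_stock.measurable).subtype_mk
  have hJ_ψ : ∫ z, J z.1.2 ∂(μ.map ψ) = ∫ z, J (b z.1.1) ∂μ :=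
    integral_map hψ.aemeasurable ((continuous_producerCost r ε _).comp_stronglyMeasurable
      (stronglyMeasurable_control T)).aestronglyMeasurable
  have hle : ∀ z : graphZ T, J (b z.1.1) ≤ J z.1.2 := fun z =>
    (hb.isOptimalControl z.1.1).2 _ z.2
  have hint_b : Integrable (fun z : graphZ T => J (b z.1.1)) μ :=
    integrable_producerCost r ε _ hb_stock.aestronglyMeasurable fun z => (ψ z).2.1
  have hint : Integrable (fun z : graphZ T => J z.1.2) μ := integrable_producerCost_control r ε _ μ
  have hintegral : ∫ z, J (b z.1.1) ∂μ = ∫ z, J z.1.2 ∂μ :=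
    (integral_mono hint_b hint hle).antisymm
      (hJ_ψ ▸ hμ.integral_producerCost_le (map_mem_admissible hμ.1 hψ fun _ => rfl))
  filter_upwards [(integral_eq_iff_of_ae_le hint_b hint (ae_of_all _ hle)).1 hintegral] with z hz
  exact hb.eq_of_producerCost_eq z.2 hz

end Potential

end ExhaustibleResource

open ExhaustibleResource in
theorem proposition7p1_general {T r ε : ℝ} {m : Measure ℝ≥0} {μ : Measure (graphZ T)}
    (hμ : IsPotentialSolution T r ε m μ) : IsNashEquilibrium T r ε m (aggregate T μ) := by
  obtain ⟨hμ_prob, rfl⟩ := hμ.1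
  obtain ⟨b, hb, hb_meas⟩ := exists_stronglyMeasurable_isBestResponseMap r ε (aggregate T μ)
  have := Measure.isProbabilityMeasure_map (μ := μ) (measurable_stock T).aemeasurable
  refine ⟨aggregate_mem_production μ, b, hb, integrable_of_mem_production
    hb_meas.aestronglyMeasurable fun x => (hb.isOptimalControl x).1.1, ?_⟩
  rw [integral_map (measurable_stock T).aemeasurable hb_meas.aestronglyMeasurable]
  exact integral_congr_ae (hμ.ae_control_eq hb hb_meas)

theorem proposition7p1 (T r ε : ℝ) (hT : 0 ≤ T) (hr : 0 ≤ r) (hε0 : 0 < ε) (hε1 : ε < 1)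
    (m : MeasureTheory.Measure NNReal) (hm : MeasureTheory.IsProbabilityMeasure m)
    (μ : MeasureTheory.Measure (ExhaustibleResource.graphZ T))
    (hμ : ExhaustibleResource.IsPotentialSolution T r ε m μ) :
    ExhaustibleResource.IsNashEquilibrium T r ε m (ExhaustibleResource.aggregate T μ) :=
  proposition7p1_general hμ
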